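/- Conventions. An order tree is a partially ordered set $T$ with a least element such that $\{s\in T: s\le t\}$ is well-ordered for every $t\in T$. The height of a node $t$ is the order type of $\{s\in T: s<t\}$, and the height of $T$ is the least ordinal $\alpha$ such that no node of $T$ has height $\alpha$. The successors of $t$ are the minimal elements of $\{s\in T: s>t\}$, and $t$ is a branching node if it has at least two distinct successors. A ray of $T$ is a non-empty, down-closed, totally ordered subset of $T$ without a maximum. A ray $R$ is branching if $R=\{s\in T: s<t\}$ for some $t\in T$. The ray space $\mathcal{R}(T)$ is the set of rays of $T$ with the subspace topology inherited from the product $2^T$ of discrete two-point spaces, each ray being identified with its characteristic function. Let $\mathcal{C}$ be a family of non-empty subsets of a topological space $X$. It is a clopen subbase if $\mathcal{C}\cup\{X\setminus C: C\in\mathcal{C}\}$ is a subbase of $X$. It is nested if $C\subseteq D$ or $D\subseteq C$ whenever $C,D\in\mathcal{C}$ intersect. It is noetherian if there is no strictly ascending sequence $C_0\subsetneq C_1\subsetneq\cdots$ in $\mathcal{C}$. A family of sets is centered if each of its non-empty finite subfamilies has non-empty intersection, and complete if each of its non-empty centered subfamilies has non-empty intersection; $\mathcal{C}$ is hereditarily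 complete if for every closed $Y\subseteq X$ the family $\{C\cap Y: C\in\mathcal{C}\}$ is complete. It has the singleton intersection property if for every strictly decreasing sequence $C_0\supsetneq C_1\supsetneq C_2\supsetneq\cdots$ in $\mathcal{C}$ the intersection $\bigcap_{n\in\mathbb{N}}C_n$ has exactly one element. Proposition. Let $X$ be a $T_0$ topological space. The following are equivalent: (i) $X$ is homeomorphic to the ray space of an order tree $T$ of height at most $\omega\cdot\omega$ such that every branching ray of $T$ contains only finitely many branching nodes of $T$; (ii) $X$ has a clopen subbase consisting of non-empty sets which is nested, noetherian, hereditarily complete and has the singleton intersection property. -/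

import Mathlib

open scoped Ordinal

universe u

namespace TreeRays

/-! ### Order trees -/

/-- A partially ordered set is an (order) tree if it has a least element (its root) and the set
`{s | s ≤ t}` is well-ordered for every node `t`. -/
class IsOrderTree (T : Type u) [PartialOrder T] : Prop where
  exists_root : ∃ t₀ : T, ∀ t : T, t₀ ≤ t
  wellOrdered : ∀ t : T, IsWellOrder (Set.Iic t) (· < ·)

section Tree

variable (T : Type u) [PartialOrder T]

/-- The strict down-set of a node of an order tree is well-ordered. -/
theorem isWellOrder_Iio [IsOrderTree T] (t : T) : IsWellOrder (Set.Iio t) (· < ·) := by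
  have := IsOrderTree.wellOrdered t
  let f : ((· < ·) : Set.Iio t → Set.Iio t → Prop) ↪r
      ((· < ·) : Set.Iic t → Set.Iic t → Prop) :=
    ⟨⟨fun s => ⟨s.1, le_of_lt s.2⟩, fun a b h => Subtype.ext (congrArg (fun z => z.1) h)⟩, Iff.rfl⟩
  exact f.isWellOrder

variable {T}

/-- The height of a node `t`: the order type of `{s | s < t}`. -/
noncomputable def nodeHeight [IsOrderTree T] (t : T) : Ordinal.{u} :=
  haveI := isWellOrder_Iio T t
  Ordinal.type ((· < ·) : Set.Iio t → Set.Iio t → Prop)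

/-- The `α`-level of a tree. -/
def level (T : Type u) [PartialOrder T] [IsOrderTree T] (α : Ordinal.{u}) : Set T :=
  {t | nodeHeight t = α}

/-- The height of a tree: the least ordinal whose level is empty. -/
noncomputable def treeHeight (T : Type u) [PartialOrder T] [IsOrderTree T] : Ordinal.{u} :=
  sInf {α | level T α = ∅}

/-- Some level of a tree is empty, so that `treeHeight` is the minimum of a non-empty set. -/
theorem exists_level_eq_empty (T : Type u) [PartialOrder T] [IsOrderTree T] :
    {α | level T α = ∅}.Nonempty := by
  by_contra h
  refine not_surjective_of_ordinal (nodeHeight : T → Ordinal.{u}) fun α => ?_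
  by_contra hα
  exact h ⟨α, Set.eq_empty_of_forall_notMem fun t ht => hα ⟨t, ht⟩⟩

/-- The successors of a node `t`: the minimal elements of `{s | t < s}`. -/
def successors (t : T) : Set T :=
  {s | Minimal (· ∈ Set.Ioi t) s}

/-- A branching node is a node with at least two distinct successors. -/
def IsBranchingNode (t : T) : Prop :=
  (successors t).Nontrivial

/-- A path is a down-closed and totally ordered set of nodes. -/
def IsPath (P : Set T) : Prop :=
  IsLowerSet P ∧ IsChain (· ≤ ·) P

/-- A ray is a path of (non-zero) limit order type: it is non-empty and has no maximum. -/
def IsRay (R : Set T) : Prop :=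
  IsPath R ∧ R.Nonempty ∧ ∀ t ∈ R, ∃ s ∈ R, t < s

/-- A ray is branching if it has a top, that is, a node `t` with `R = {s | s < t}`. -/
def IsBranchingRay (R : Set T) : Prop :=
  IsRay R ∧ ∃ t : T, R = Set.Iio t

variable (T)

/-- The set of rays of `T`. -/
def RaySpace : Type u := {R : Set T // IsRay R}

variable {T}

open Classical in
/-- The characteristic function of a ray, as a point of the product `2 ^ T`. -/
noncomputable def RaySpace.indicator (R : RaySpace T) : T → Bool :=
  fun t => decide (t ∈ R.1)

/-- The ray space carries the subspace topology of the product `2 ^ T`, with `2` discrete. -/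
noncomputable instance : TopologicalSpace (RaySpace T) :=
  TopologicalSpace.induced RaySpace.indicator inferInstance

end Tree

/-! ### Properties of families of subsets -/

section Families

variable {X : Type u}

/-- The members of `𝒞` together with their complements form a subbase of `X`. -/
def IsClopenSubbase [TopologicalSpace X] (𝒞 : Set (Set X)) : Prop :=
  ‹TopologicalSpace X› = TopologicalSpace.generateFrom (𝒞 ∪ {U | ∃ C ∈ 𝒞, U = Cᶜ})

/-- Any two members that intersect are comparable by inclusion. -/
def IsNested (𝒞 : Set (Set X)) : Prop :=
  ∀ C ∈ 𝒞, ∀ D ∈ 𝒞, (C ∩ D).Nonempty → C ⊆ D ∨ D ⊆ C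

/-- There is no strictly ascending sequence in `𝒞`. -/
def IsNoetherianFamily (𝒞 : Set (Set X)) : Prop :=
  ¬ ∃ C : ℕ → Set X, (∀ n, C n ∈ 𝒞) ∧ ∀ n, C n ⊂ C (n + 1)

/-- All non-empty finite subfamilies have non-empty intersection. -/
def IsCentered (𝒞 : Set (Set X)) : Prop :=
  ∀ ℱ ⊆ 𝒞, ℱ.Finite → ℱ.Nonempty → (⋂₀ ℱ).Nonempty

/-- All (non-empty) centered subfamilies have non-empty intersection. -/
def IsCompleteFamily (𝒞 : Set (Set X)) : Prop :=
  ∀ 𝒜 ⊆ 𝒞, 𝒜.Nonempty → IsCentered 𝒜 → (⋂₀ 𝒜).Nonempty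

/-- The traces of `𝒞` on each closed subspace `Y` form a complete family of subsets of `Y`. -/
def IsHereditarilyComplete [TopologicalSpace X] (𝒞 : Set (Set X)) : Prop :=
  ∀ Y : Set X, IsClosed Y → IsCompleteFamily {D : Set Y | ∃ C ∈ 𝒞, D = Subtype.val ⁻¹' C}

/-- Every strictly decreasing sequence in `𝒞` has exactly one point in its intersection. -/
def HasSingletonIntersectionProperty (𝒞 : Set (Set X)) : Prop :=
  ∀ C : ℕ → Set X, (∀ n, C n ∈ 𝒞) → (∀ n, C (n + 1) ⊂ C n) → ∃! x, x ∈ ⋂ n, C n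

end Families

end TreeRays

/-! From trees to families: the cone of a node consists of the points whose ray contains it, and the
family is that of the non-empty cones. Rays are chains, so cones are nested; the tree is
well-founded, so they are noetherian; limits of rays give hereditary completeness. Only the
singleton property uses the height and the branching condition. A strictly decreasing sequence of
cones comes from nodes t₀ < t₁ < ⋯ whose down-closure is a ray. If two points lay in all the cones,
this ray would have a top, hence finitely many branching nodes. But below ω·ω there are eventually
no limit nodes between the tₙ, and then each strict inclusion of cones yields a branching node
between tₙ and tₙ₊₁ (`exists_isBranchingNode_between`).

From families to trees: each member has only finitely many supersets (`finite_supersets`), so the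
family together with the whole space is a tree of height at most ω under reverse inclusion. A point
that has a smallest member around it is not yet seen by any ray, so `ChainTree` stacks ω copies of
that member, which raises the height to at most ω·ω. Stacked nodes do not branch, which leaves
finitely many branching nodes below any node. Sending a point to the ray of all sets around it is
injective by T₀, and surjective by the stacks and the singleton property. -/

namespace TreeRays

/-! ### Heights and branching in order trees -/

section OrderTree

variable {T : Type u} [PartialOrder T] [IsOrderTree T]

theorem le_or_le_of_le {a b t : T} (ha : a ≤ t) (hb : b ≤ t) : a ≤ b ∨ b ≤ a := by
  have := IsOrderTree.wellOrdered t
  rcases trichotomous_of (· < ·) (⟨a, ha⟩ : Set.Iic t) ⟨b, hb⟩ with h | h | h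
  · exact Or.inl (le_of_lt h)
  · exact Or.inl (le_of_eq (congrArg Subtype.val h))
  · exact Or.inr (le_of_lt h)

theorem IsOrderTree.wellFoundedLT : WellFoundedLT T := by
  refine ⟨⟨fun t => ?_⟩⟩
  have := IsOrderTree.wellOrdered t
  have key : ∀ s : Set.Iic t, Acc (· < ·) s.1 := fun s =>
    (IsWellFounded.wf (r := ((· < ·) : Set.Iic t → Set.Iic t → Prop))).induction
      (C := fun s => Acc (· < ·) s.1) s
      fun s ih => Acc.intro _ fun y hy => ih ⟨y, hy.le.trans s.2⟩ hy
  exact key ⟨t, le_rfl⟩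

theorem typein_Iio {s t : T} (h : s < t) :
    haveI := isWellOrder_Iio T t
    Ordinal.typein ((· < ·) : Set.Iio t → Set.Iio t → Prop) ⟨s, h⟩ = nodeHeight s := by
  have := isWellOrder_Iio T t
  have := isWellOrder_Iio T s
  rw [← Ordinal.type_subrel]
  exact Ordinal.type_eq.2 ⟨⟨⟨fun x => ⟨x.1.1, x.2⟩, fun x => ⟨⟨x.1, lt_trans x.2 h⟩, x.2⟩,
    fun _ => rfl, fun _ => rfl⟩, Iff.rfl⟩⟩

theorem nodeHeight_lt {s t : T} (h : s < t) : nodeHeight s < nodeHeight t := by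
  have := isWellOrder_Iio T t
  rw [← typein_Iio h]
  exact Ordinal.typein_lt_type _ _

theorem nodeHeight_mono {s t : T} (h : s ≤ t) : nodeHeight s ≤ nodeHeight t :=
  h.eq_or_lt.elim (fun h => h ▸ le_rfl) fun h => (nodeHeight_lt h).le

theorem exists_nodeHeight_eq {t : T} {α : Ordinal.{u}} (h : α < nodeHeight t) :
    ∃ s < t, nodeHeight s = α := by
  have := isWellOrder_Iio T t
  obtain ⟨⟨s, hs⟩, rfl⟩ := Ordinal.typein_surj ((· < ·) : Set.Iio t → Set.Iio t → Prop) h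
  exact ⟨s, hs, (typein_Iio hs).symm⟩

/-- Heights take every smaller value below `t`, so induction along the tree suffices. This bounds
heights without computing them. -/
theorem nodeHeight_le_of_strictMono {g : T → Ordinal.{u}} (hg : StrictMono g) (t : T) :
    nodeHeight t ≤ g t := by
  have := IsOrderTree.wellFoundedLT (T := T)
  induction t using WellFoundedLT.induction with
  | _ t ih =>
    refine le_of_forall_lt fun α hα => ?_
    obtain ⟨s, hs, rfl⟩ := exists_nodeHeight_eq hα
    exact (ih s hs).trans_lt (hg hs)

theorem treeHeight_le_of_strictMono {g : T → Ordinal.{u}} (hg : StrictMono g) {o : Ordinal.{u}}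
    (ho : ∀ t, g t < o) : treeHeight T ≤ o :=
  csInf_le' (Set.eq_empty_of_forall_notMem fun t ht =>
    ((nodeHeight_le_of_strictMono hg t).trans_lt (ho t)).ne ht)

theorem nodeHeight_lt_treeHeight (t : T) : nodeHeight t < treeHeight T := by
  have h : level T (treeHeight T) = ∅ := csInf_mem (exists_level_eq_empty T)
  by_contra! hle
  rcases hle.eq_or_lt with he | hl
  · exact h.subset (show t ∈ level T _ from he.symm)
  · obtain ⟨s, -, hs⟩ := exists_nodeHeight_eq hl
    exact h.subset (show s ∈ level T _ from hs)

theorem exists_lt_minimal_notMem {S : Set T} {t : T} (ht : t ∉ S) :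
    ∃ w ≤ t, w ∉ S ∧ ∀ z < w, z ∈ S := by
  have := IsOrderTree.wellFoundedLT (T := T)
  obtain ⟨w, hw, hmin⟩ := (wellFounded_lt (α := T)).has_min {w | w ≤ t ∧ w ∉ S} ⟨t, le_rfl, ht⟩
  exact ⟨w, hw.1, hw.2, fun z hz => by_contra fun h => hmin z ⟨hz.le.trans hw.1, h⟩ hz⟩

/-- If a ray `S` leaves the predecessors of `t` between `s` and `t`, and there is no limit node
between `s` and `t`, then `S` leaves them at a branching node. -/
theorem exists_isBranchingNode_between {S : Set T} (hS : IsRay S) {s t : T} (hst : s < t)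
    (hs : s ∈ S) (ht : t ∉ S)
    (hlim : ∀ w, s < w → w ≤ t → ∃ β, nodeHeight w = Order.succ β) :
    ∃ v, s ≤ v ∧ v < t ∧ IsBranchingNode v := by
  obtain ⟨w, hwt, hwS, hw⟩ := exists_lt_minimal_notMem ht
  have hsw : s < w := by
    rcases le_or_le_of_le hst.le hwt with h | h
    · exact lt_of_le_of_ne h fun e => hwS (e ▸ hs)
    · exact absurd (hS.1.1 h hs) hwS
  obtain ⟨β, hβ⟩ := hlim w hsw hwt
  obtain ⟨v, hvw, hv⟩ := exists_nodeHeight_eq (hβ ▸ Order.lt_succ β)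
  have hmax : ∀ z < w, z ≤ v := fun z hz => by
    rcases le_or_le_of_le hz.le hvw.le with h | h
    · exact h
    · rcases h.eq_or_lt with h | h
      · exact h.ge
      · have h1 := nodeHeight_lt h
        have h2 := nodeHeight_lt hz
        rw [hβ, Order.lt_succ_iff, ← hv] at h2
        exact absurd h1 h2.not_gt
  -- `w` is one successor of `v`, outside `S`; since `S` has no maximum, it continues above `v`
  -- through another one, `w'`.
  obtain ⟨v', hv'S, hvv'⟩ := hS.2.2 v (hw v hvw)
  obtain ⟨w', hw'v', hw'S, hw'⟩ := exists_lt_minimal_notMem (S := {z | ¬ v < z}) (not_not.2 hvv')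
  refine ⟨v, hmax s hsw, hvw.trans_le hwt, w, ⟨hvw, fun z hz hzw => ?_⟩, w',
    ⟨not_not.1 hw'S, fun z hz hzw => ?_⟩, fun e => hwS (e ▸ hS.1.1 hw'v' hv'S)⟩
  · rcases hzw.eq_or_lt with h | h
    · exact h.ge
    · exact absurd (hmax z h) (not_le_of_gt hz)
  · rcases hzw.eq_or_lt with h | h
    · exact h.ge
    · exact absurd hz (hw' z h)

/-- A bounded sequence in a tree of height at most `ω * ω` eventually skips no limit
nodes. -/
theorem exists_forall_between_succ (hT : treeHeight T ≤ ω * ω) {t : ℕ → T} {u : T}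
    (hu : ∀ n, t n < u) :
    ∃ N, ∀ m w, t N < w → w ≤ t m → ∃ β, nodeHeight w = Order.succ β := by
  classical
  have hex : ∃ k : ℕ, ∀ n, nodeHeight (t n) < ω * (k : Ordinal.{u}) := by
    obtain ⟨q, hq, hlt⟩ := (Ordinal.lt_mul_iff_of_isSuccLimit Ordinal.isSuccLimit_omega0).1
      ((nodeHeight_lt_treeHeight u).trans_le hT)
    obtain ⟨k, rfl⟩ := Ordinal.lt_omega0.1 hq
    exact ⟨k, fun n => (nodeHeight_lt (hu n)).trans hlt⟩
  have hk := Nat.find_spec hex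
  have hmin := fun m => Nat.find_min hex (m := m)
  generalize Nat.find hex = k at hk hmin
  cases k with
  | zero => simpa using hk 0
  | succ k =>
    have := hmin k (Nat.lt_succ_self k)
    push Not at this
    obtain ⟨N, hN⟩ := this
    -- By minimality of the bound, all heights strictly above `t N` and up to some `t m` lie
    -- strictly between ω·k and ω·(k+1), where every ordinal is a successor.
    refine ⟨N, fun m w hNw hwm => ?_⟩
    have h1 := hN.trans_lt (nodeHeight_lt hNw)
    have h2 := (nodeHeight_mono hwm).trans_lt (hk m)
    rw [Nat.cast_succ, mul_add_one, Ordinal.lt_add_iff_of_isSuccLimit Ordinal.isSuccLimit_omega0]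
      at h2
    obtain ⟨d, hd, hlt⟩ := h2
    obtain ⟨e, he⟩ := exists_add_of_le h1.le
    rw [he] at h1 hlt ⊢
    have hed := (add_lt_add_iff_left _).1 hlt
    obtain ⟨j, rfl⟩ := Ordinal.lt_omega0.1 (hed.trans hd)
    cases j with
    | zero => simp at h1
    | succ j =>
      refine ⟨ω * k + j, ?_⟩
      rw [Order.succ_eq_add_one, add_assoc, Nat.cast_succ]

end OrderTree

end TreeRays

namespace TreeRays

/-! ### The topology of the ray space -/

section RaySpaceTopology

variable {T : Type u} [PartialOrder T]

theorem RaySpace.isClopen_setOf_mem (t : T) : IsClopen {R : RaySpace T | t ∈ R.1} := by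
  have h : {R : RaySpace T | t ∈ R.1} = (fun R => R.indicator t) ⁻¹' {true} := by
    ext R
    simp [RaySpace.indicator]
  rw [h]
  exact (isClopen_discrete _).preimage
    ((continuous_apply t).comp (continuous_induced_dom (f := RaySpace.indicator)))

theorem RaySpace.tendsto_of_eventually {ι : Type*} {l : Filter ι} {f : ι → RaySpace T}
    {R : RaySpace T} (h : ∀ t, ∀ᶠ i in l, (t ∈ (f i).1 ↔ t ∈ R.1)) :
    Filter.Tendsto f l (nhds R) := by
  rw [nhds_induced, Filter.tendsto_comap_iff, tendsto_pi_nhds]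
  refine fun t => Filter.Tendsto.congr' (f₁ := fun _ => R.indicator t) ?_ tendsto_const_nhds
  filter_upwards [h t] with i hi
  simp [RaySpace.indicator, hi]

theorem RaySpace.continuous_of_isClopen {X : Type*} [TopologicalSpace X] {f : X → RaySpace T}
    (h : ∀ t, IsClopen {x | t ∈ (f x).1}) : Continuous f := by
  refine continuous_iff_continuousAt.2 fun x => RaySpace.tendsto_of_eventually fun t => ?_
  by_cases hx : t ∈ (f x).1
  · filter_upwards [(h t).isOpen.mem_nhds hx] with y hy
    exact iff_of_true hy hx
  · filter_upwards [(h t).compl.isOpen.mem_nhds hx] with y hy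
    exact iff_of_false hy hx

end RaySpaceTopology

/-! ### From trees to families: the cones -/

section ConeFamily

variable {T : Type u} [PartialOrder T] {X : Type u}

/-- The non-empty sets of points whose ray, under `e`, contains a given node. -/
def coneFamily (e : X → RaySpace T) : Set (Set X) :=
  {C | C.Nonempty ∧ ∃ t, C = {x | t ∈ (e x).1}}

theorem exists_nodes_of_coneFamily {e : X → RaySpace T} {ι : Type*} {C : ι → Set X}
    (hC : ∀ n, C n ∈ coneFamily e) : ∃ t : ι → T, ∀ n, C n = {x | t n ∈ (e x).1} :=
  ⟨fun n => (hC n).2.choose, fun n => (hC n).2.choose_spec⟩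

theorem RaySpace.le_or_le {R : RaySpace T} {s t : T} (hs : s ∈ R.1) (ht : t ∈ R.1) :
    s ≤ t ∨ t ≤ s :=
  R.2.1.2.total hs ht

theorem lt_of_cone_ssubset {e : X → RaySpace T} {s t : T}
    (hne : {x | t ∈ (e x).1}.Nonempty) (h : {x | t ∈ (e x).1} ⊂ {x | s ∈ (e x).1}) : s < t := by
  obtain ⟨x, hx⟩ := hne
  have hnle : ¬ t ≤ s := fun hts => h.2 fun y hy => (e y).2.1.1 hts hy
  exact lt_of_le_not_ge ((RaySpace.le_or_le (h.1 hx) hx).resolve_right hnle) hnle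

theorem isClopenSubbase_coneFamily [TopologicalSpace X] (e : X ≃ₜ RaySpace T) :
    IsClopenSubbase (coneFamily e) := by
  refine le_antisymm (le_generateFrom ?_) ?_
  · rintro U (⟨-, t, rfl⟩ | ⟨_, ⟨-, t, rfl⟩, rfl⟩)
    · exact ((RaySpace.isClopen_setOf_mem t).preimage e.continuous).isOpen
    · exact ((RaySpace.isClopen_setOf_mem t).preimage e.continuous).compl.isOpen
  · refine le_trans ?_ e.isInducing.eq_induced.ge
    rw [← continuous_iff_le_induced]
    refine @RaySpace.continuous_of_isClopen _ _ _ (_) _ fun t => ?_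
    -- Empty cones are not in the family, but they are clopen in any topology.
    rcases Set.eq_empty_or_nonempty {x | t ∈ (e x).1} with h | h
    · rw [h]
      exact @isClopen_empty _ (_)
    · exact ⟨(@isOpen_compl_iff _ _ (_)).1
        (TopologicalSpace.isOpen_generateFrom_of_mem (Or.inr ⟨_, ⟨h, t, rfl⟩, rfl⟩)),
        TopologicalSpace.isOpen_generateFrom_of_mem (Or.inl ⟨h, t, rfl⟩)⟩

theorem isNested_coneFamily (e : X → RaySpace T) : IsNested (coneFamily e) := by
  rintro _ ⟨-, s, rfl⟩ _ ⟨-, t, rfl⟩ ⟨x, hs, ht⟩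
  rcases RaySpace.le_or_le hs ht with h | h
  · exact Or.inr fun y hy => (e y).2.1.1 h hy
  · exact Or.inl fun y hy => (e y).2.1.1 h hy

theorem isNoetherianFamily_coneFamily [IsOrderTree T] (e : X → RaySpace T) :
    IsNoetherianFamily (coneFamily e) := by
  rintro ⟨C, hC, hlt⟩
  have := IsOrderTree.wellFoundedLT (T := T)
  obtain ⟨t, ht⟩ := exists_nodes_of_coneFamily hC
  refine (wellFounded_iff_isEmpty_descending_chain.1 (wellFounded_lt (α := T))).false
    ⟨t, fun n => lt_of_cone_ssubset (e := e) (ht n ▸ (hC n).1) (ht n ▸ ht (n + 1) ▸ hlt n)⟩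

/-- Centeredness makes the nodes involved a chain. A greatest node settles the claim; otherwise the
down-closure of the chain is a ray, and it is a limit of rays of points of `Y` if no point of `Y`
already lies in all the cones. -/
theorem isHereditarilyComplete_coneFamily [IsOrderTree T] [TopologicalSpace X]
    (e : X ≃ₜ RaySpace T) : IsHereditarilyComplete (coneFamily e) := by
  intro Y hY 𝒜 h𝒜 hne hcent
  let A : Set T := {t | (Subtype.val ⁻¹' {x | t ∈ (e x).1} : Set Y) ∈ 𝒜}
  have hA : ∀ D ∈ 𝒜, ∃ t ∈ A, D = Subtype.val ⁻¹' {x | t ∈ (e x).1} := fun D hD => by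
    obtain ⟨C, ⟨-, t, rfl⟩, rfl⟩ := h𝒜 hD
    exact ⟨t, hD, rfl⟩
  suffices h : ∃ x ∈ Y, ∀ t ∈ A, t ∈ (e x).1 by
    obtain ⟨x, hx, h⟩ := h
    refine ⟨⟨x, hx⟩, fun D hD => ?_⟩
    obtain ⟨t, ht, rfl⟩ := hA D hD
    exact h t ht
  obtain ⟨D₀, hD₀⟩ := hne
  obtain ⟨a₀, ha₀, -⟩ := hA D₀ hD₀
  have hmeet : ∀ s ∈ A, ∀ t ∈ A, ∃ x ∈ Y, s ∈ (e x).1 ∧ t ∈ (e x).1 := fun s hs t ht => by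
    obtain ⟨x, hx⟩ := hcent {Subtype.val ⁻¹' {x | s ∈ (e x).1}, Subtype.val ⁻¹' {x | t ∈ (e x).1}}
      (by rintro _ (rfl | rfl) <;> assumption) (Set.toFinite _) ⟨_, Or.inl rfl⟩
    exact ⟨x, x.2, hx _ (Or.inl rfl), hx _ (Or.inr rfl)⟩
  have htot : ∀ s ∈ A, ∀ t ∈ A, s ≤ t ∨ t ≤ s := fun s hs t ht => by
    obtain ⟨x, -, h1, h2⟩ := hmeet s hs t ht
    exact RaySpace.le_or_le h1 h2
  by_cases hmax : ∃ m ∈ A, ∀ t ∈ A, t ≤ m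
  · obtain ⟨m, hm, hle⟩ := hmax
    obtain ⟨x, hx, h, -⟩ := hmeet m hm m hm
    exact ⟨x, hx, fun t ht => (e x).2.1.1 (hle t ht) h⟩
  push Not at hmax
  let P : RaySpace T := ⟨{s | ∃ t ∈ A, s ≤ t}, by
    refine ⟨⟨fun a b hba ⟨t, ht, hat⟩ => ⟨t, ht, hba.trans hat⟩, ?_⟩, ⟨a₀, a₀, ha₀, le_rfl⟩, ?_⟩
    · rintro a ⟨s, hs, has⟩ b ⟨t, ht, hbt⟩ -
      rcases htot s hs t ht with h | h
      · exact le_or_le_of_le (has.trans h) hbt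
      · exact le_or_le_of_le has (hbt.trans h)
    · rintro a ⟨s, hs, has⟩
      obtain ⟨t, ht, hts⟩ := hmax s hs
      exact ⟨t, ⟨t, ht, le_rfl⟩,
        has.trans_lt (lt_of_le_not_ge ((htot s hs t ht).resolve_right hts) hts)⟩⟩
  by_contra! hcon
  have hx : ∀ t : A, ∃ x ∈ Y, t.1 ∈ (e x).1 := fun t => by
    obtain ⟨x, hx, h, -⟩ := hmeet t.1 t.2 t.1 t.2
    exact ⟨x, hx, h⟩
  choose x hxY hxt using hx
  have : Nonempty A := ⟨⟨a₀, ha₀⟩⟩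
  have : IsDirectedOrder A := ⟨fun s t => (htot s.1 s.2 t.1 t.2).elim
    (fun h => ⟨t, h, le_rfl⟩) fun h => ⟨s, le_rfl, h⟩⟩
  have hlim : Filter.Tendsto (fun t => e (x t)) Filter.atTop (nhds P) := by
    refine RaySpace.tendsto_of_eventually fun s => ?_
    by_cases hs : s ∈ P.1
    · obtain ⟨t, ht, hst⟩ := hs
      filter_upwards [Filter.eventually_ge_atTop (⟨t, ht⟩ : A)] with t' ht'
      exact iff_of_true ((e (x t')).2.1.1 (hst.trans ht') (hxt t')) ⟨t, ht, hst⟩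
    -- A node above all of `A` is in no ray of a point of `Y`, by `hcon`; any other node outside `P`
    -- is incomparable with some `t ∈ A`, hence in no ray through a node of `A` above `t`.
    · by_cases hall : ∀ t ∈ A, t ≤ s
      · refine Filter.Eventually.of_forall fun t => iff_of_false (fun h => ?_) hs
        obtain ⟨r, hr, hn⟩ := hcon (x t) (hxY t)
        exact hn ((e (x t)).2.1.1 (hall r hr) h)
      push Not at hall
      obtain ⟨t, ht, hts⟩ := hall
      filter_upwards [Filter.eventually_ge_atTop (⟨t, ht⟩ : A)] with t' ht'
      refine iff_of_false (fun h => ?_) hs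
      rcases RaySpace.le_or_le h (hxt t') with h | h
      · exact hs ⟨t', t'.2, h⟩
      · exact hts (le_trans ht' h)
  have hlim' : Filter.Tendsto x Filter.atTop (nhds (e.symm P)) := by
    simpa [Function.comp_def] using (e.symm.continuous.tendsto P).comp hlim
  have hmem := hY.mem_of_tendsto hlim' (Filter.Eventually.of_forall hxY)
  obtain ⟨t, ht, hn⟩ := hcon _ hmem
  exact hn ((e.apply_symm_apply P).symm ▸ (⟨t, ht, le_rfl⟩ : t ∈ P.1))

theorem hasSingletonIntersectionProperty_coneFamily [IsOrderTree T]
    (hT : treeHeight T ≤ ω * ω)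
    (hB : ∀ R : Set T, IsBranchingRay R → {t ∈ R | IsBranchingNode t}.Finite)
    {e : X → RaySpace T} (he : Function.Bijective e) :
    HasSingletonIntersectionProperty (coneFamily e) := by
  intro C hC hlt
  obtain ⟨t, ht⟩ := exists_nodes_of_coneFamily hC
  have hstep : ∀ n, t n < t (n + 1) := fun n =>
    lt_of_cone_ssubset (e := e) (ht (n + 1) ▸ (hC (n + 1)).1) (ht n ▸ ht (n + 1) ▸ hlt n)
  have hmono := strictMono_nat_of_lt_succ hstep
  have hray : IsRay {s | ∃ n, s ≤ t n} := by
    refine ⟨⟨fun a b hba ⟨n, hn⟩ => ⟨n, hba.trans hn⟩, ?_⟩, ⟨t 0, 0, le_rfl⟩, ?_⟩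
    · rintro a ⟨m, hm⟩ b ⟨n, hn⟩ -
      exact le_or_le_of_le (hm.trans (hmono.monotone (le_max_left m n)))
        (hn.trans (hmono.monotone (le_max_right m n)))
    · rintro a ⟨m, hm⟩
      exact ⟨t (m + 1), ⟨m + 1, le_rfl⟩, hm.trans_lt (hstep m)⟩
  obtain ⟨x, hx⟩ := he.2 ⟨_, hray⟩
  have hx' : (e x).1 = {s | ∃ n, s ≤ t n} := congrArg Subtype.val hx
  refine ⟨x, Set.mem_iInter.2 fun n => ?_, fun y hy => he.1 (Subtype.ext ?_)⟩
  · rw [ht n]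
    exact hx'.ge ⟨n, le_rfl⟩
  have hty : ∀ n, t n ∈ (e y).1 := fun n => by
    have := Set.mem_iInter.1 hy n
    rwa [ht n] at this
  rw [hx']
  by_contra hne
  obtain ⟨z, hzy, hz⟩ : ∃ z ∈ (e y).1, z ∉ {s | ∃ n, s ≤ t n} := by
    by_contra! h
    exact hne (Set.Subset.antisymm h fun s ⟨n, hn⟩ => (e y).2.1.1 hn (hty n))
  -- The first node of the ray of `y` outside the down-closure is a top of it, so the branching
  -- condition applies.
  obtain ⟨u, huz, hu, hmin⟩ := exists_lt_minimal_notMem hz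
  have htu : ∀ n, t n < u := fun n => by
    have huy := (e y).2.1.1 huz hzy
    rcases RaySpace.le_or_le (hty n) huy with h | h
    · exact lt_of_le_of_ne h fun h => hu ⟨n, h.ge⟩
    · exact absurd ⟨n, h⟩ hu
  have hfin := hB _ ⟨hray, u, Set.Subset.antisymm (fun s ⟨n, hn⟩ => hn.trans_lt (htu n)) hmin⟩
  obtain ⟨N, hN⟩ := exists_forall_between_succ hT htu
  have hbound : ∀ᶠ n in Filter.atTop, ∀ b ∈ {s ∈ {s | ∃ n, s ≤ t n} | IsBranchingNode s},
      b < t n := (hfin.eventually_all).2 fun b ⟨⟨n, hn⟩, _⟩ => by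
    filter_upwards [Filter.eventually_gt_atTop n] with m hm
    exact hn.trans_lt (hmono hm)
  obtain ⟨n, hn, hNn⟩ := (hbound.and (Filter.eventually_ge_atTop N)).exists
  obtain ⟨p, hp, hp'⟩ := Set.exists_of_ssubset (hlt n)
  rw [ht n] at hp
  rw [ht (n + 1)] at hp'
  obtain ⟨v, hnv, hv, hvb⟩ := exists_isBranchingNode_between (e p).2 (hstep n) hp hp'
    fun w hw hw' => hN (n + 1) w ((hmono.monotone hNn).trans_lt hw) hw'
  exact (hn v ⟨⟨n + 1, hv.le⟩, hvb⟩).not_ge hnv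

end ConeFamily

end TreeRays

namespace TreeRays

/-! ### Finiteness of the supersets of a member -/

section Supersets

variable {X : Type u} {𝒞 : Set (Set X)}

/-- Infinitely many supersets would contain a strictly decreasing sequence, as ascending ones are
excluded. Its intersection is a single point, which must lie in `C`; but hereditary completeness on
the closed set `Cᶜ` puts a point of the intersection outside `C`. -/
theorem finite_supersets [TopologicalSpace X] (hne : ∀ C ∈ 𝒞, C.Nonempty)
    (hsub : IsClopenSubbase 𝒞) (hnest : IsNested 𝒞) (hnoeth : IsNoetherianFamily 𝒞)
    (hcomp : IsHereditarilyComplete 𝒞) (hsip : HasSingletonIntersectionProperty 𝒞)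
    {C : Set X} (hC : C ∈ 𝒞) : {D ∈ 𝒞 | C ⊆ D}.Finite := by
  by_contra hinf
  let f := Set.Infinite.natEmbedding _ hinf
  obtain ⟨g, hg⟩ := exists_increasing_or_nonincreasing_subseq
    (fun A B : Set X => A ⊂ B) (fun n => (f n).1)
  rcases hg with hg | hg
  · exact hnoeth ⟨fun n => (f (g n)).1, fun n => (f (g n)).2.1, fun n => hg _ _ n.lt_succ_self⟩
  set D : ℕ → Set X := fun n => (f (g n)).1 with hDdef
  have hD : ∀ n, D n ∈ 𝒞 := fun n => (f (g n)).2.1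
  have hCD : ∀ n, C ⊆ D n := fun n => (f (g n)).2.2
  obtain ⟨c, hc⟩ := hne C hC
  have hlt : ∀ n, D (n + 1) ⊂ D n := fun n => by
    have hdiff : D n ≠ D (n + 1) := fun h => by
      simpa using f.injective (Subtype.ext h)
    rcases hnest _ (hD n) _ (hD (n + 1)) ⟨c, hCD _ hc, hCD _ hc⟩ with h | h
    · exact absurd (Set.ssubset_iff_subset_ne.2 ⟨h, hdiff⟩) (hg n (n + 1) n.lt_succ_self)
    · exact Set.ssubset_iff_subset_ne.2 ⟨h, hdiff.symm⟩
  have hanti : Antitone D := antitone_nat_of_succ_le fun n => (hlt n).1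
  obtain ⟨x, -, hx⟩ := hsip D hD hlt
  have hopen : IsOpen C := by
    rw [hsub]
    exact TopologicalSpace.isOpen_generateFrom_of_mem (Or.inl hC)
  obtain ⟨y, hy⟩ := hcomp Cᶜ hopen.isClosed_compl
    (Set.range fun n => (Subtype.val ⁻¹' D n : Set (Cᶜ : Set X)))
    (by rintro _ ⟨n, rfl⟩; exact ⟨D n, hD n, rfl⟩) (Set.range_nonempty _) (by
      intro ℱ hℱ hfin _
      have h : ∀ᶠ n in Filter.atTop, ∀ F ∈ ℱ, Subtype.val ⁻¹' D n ⊆ F :=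
        hfin.eventually_all.2 fun F hF => by
          obtain ⟨m, rfl⟩ := hℱ hF
          filter_upwards [Filter.eventually_ge_atTop m] with n hn
          exact Set.preimage_mono (hanti hn)
      obtain ⟨n, hn⟩ := h.exists
      -- A point of `D n` outside `D (n + 1)` is outside `C`, so the traces on `Cᶜ` are non-empty.
      obtain ⟨z, hz, hzn⟩ := Set.exists_of_ssubset (hlt n)
      exact ⟨⟨z, fun h => hzn (hCD _ h)⟩, fun F hF => hn F hF hz⟩)
  refine y.2 ?_
  rw [hx y.1 (Set.mem_iInter.2 fun n => hy _ ⟨n, rfl⟩),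
    ← hx c (Set.mem_iInter.2 fun n => hCD n hc)]
  exact hc

end Supersets

/-! ### From families to trees: stacking copies of members -/

section ChainTree

variable {X : Type u}

/-- A family of sets that forms a tree of height at most `ω` under reverse inclusion, with the
whole space as its root. -/
structure IsTreeFamily (𝒟 : Set (Set X)) : Prop where
  univ_mem : Set.univ ∈ 𝒟
  nested : IsNested 𝒟
  total : ∀ C ∈ 𝒟, ∀ D ∈ 𝒟, ∀ E ∈ 𝒟, E ⊆ C → E ⊆ D → C ⊆ D ∨ D ⊆ C
  finite : ∀ C ∈ 𝒟, {D ∈ 𝒟 | C ⊆ D}.Finite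

/-- `C` is the smallest member of `𝒟` containing some point. -/
def IsLeastAtPoint (𝒟 : Set (Set X)) (C : Set X) : Prop :=
  ∃ x ∈ C, ∀ D ∈ 𝒟, x ∈ D → C ⊆ D

/-- The tree obtained from `𝒟`, ordered by reverse inclusion, by replacing each member that is
smallest at some point by an increasing sequence of nodes. -/
def ChainTree (𝒟 : Set (Set X)) : Type u :=
  {p : Set X × ℕ // p.1 ∈ 𝒟 ∧ (p.2 = 0 ∨ IsLeastAtPoint 𝒟 p.1)}

namespace ChainTree

variable {𝒟 : Set (Set X)}

instance : PartialOrder (ChainTree 𝒟) where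
  le p q := q.1.1 ⊂ p.1.1 ∨ p.1.1 = q.1.1 ∧ p.1.2 ≤ q.1.2
  le_refl p := Or.inr ⟨rfl, le_rfl⟩
  le_trans := by
    rintro p q r (h | ⟨h, h'⟩) (k | ⟨k, k'⟩)
    · exact Or.inl (k.trans h)
    · exact Or.inl (k ▸ h)
    · exact Or.inl (h ▸ k)
    · exact Or.inr ⟨h.trans k, h'.trans k'⟩
  le_antisymm := by
    rintro p q (h | ⟨h, h'⟩) (k | ⟨k, k'⟩)
    · exact absurd (k.trans h) (ssubset_irrefl _)
    · exact absurd (k ▸ h) (ssubset_irrefl _)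
    · exact absurd (h ▸ k) (ssubset_irrefl _)
    · exact Subtype.ext (Prod.ext h (le_antisymm h' k'))

theorem le_def {p q : ChainTree 𝒟} :
    p ≤ q ↔ q.1.1 ⊂ p.1.1 ∨ p.1.1 = q.1.1 ∧ p.1.2 ≤ q.1.2 := Iff.rfl

theorem lt_def {p q : ChainTree 𝒟} :
    p < q ↔ q.1.1 ⊂ p.1.1 ∨ p.1.1 = q.1.1 ∧ p.1.2 < q.1.2 := by
  rw [lt_iff_le_not_ge, le_def, le_def]
  constructor
  · rintro ⟨h | ⟨h, -⟩, k⟩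
    · exact Or.inl h
    · exact Or.inr ⟨h, lt_of_not_ge fun h' => k (Or.inr ⟨h.symm, h'⟩)⟩
  · rintro (h | ⟨h, h'⟩)
    · refine ⟨Or.inl h, ?_⟩
      rintro (k | ⟨k, -⟩)
      · exact ssubset_irrefl _ (k.trans h)
      · exact h.ne k
    · refine ⟨Or.inr ⟨h, h'.le⟩, ?_⟩
      rintro (k | ⟨-, k⟩)
      · exact k.ne h
      · exact h'.not_ge k

theorem subset_of_le {p q : ChainTree 𝒟} (h : p ≤ q) : q.1.1 ⊆ p.1.1 :=
  h.elim (fun h => h.1) fun h => h.1.ge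

theorem le_or_le_of_subset {p q : ChainTree 𝒟} (h : p.1.1 ⊆ q.1.1 ∨ q.1.1 ⊆ p.1.1) :
    p ≤ q ∨ q ≤ p := by
  by_cases he : p.1.1 = q.1.1
  · exact (le_total p.1.2 q.1.2).imp (fun h => Or.inr ⟨he, h⟩) fun h => Or.inr ⟨he.symm, h⟩
  · exact h.symm.imp (fun h => Or.inl (Set.ssubset_iff_subset_ne.2 ⟨h, Ne.symm he⟩))
      fun h => Or.inl (Set.ssubset_iff_subset_ne.2 ⟨h, he⟩)

/-- The number of members of `𝒟` that properly contain `C`. -/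
noncomputable def depth (𝒟 : Set (Set X)) (C : Set X) : ℕ :=
  {D ∈ 𝒟 | C ⊂ D}.ncard

theorem depth_lt (h𝒟 : IsTreeFamily 𝒟) {C D : Set X} (hC : C ∈ 𝒟) (hD : D ∈ 𝒟) (h : C ⊂ D) :
    depth 𝒟 D < depth 𝒟 C := by
  have hfin : {E ∈ 𝒟 | C ⊂ E}.Finite :=
    (h𝒟.finite C hC).subset fun E hE => ⟨hE.1, hE.2.1⟩
  refine Set.ncard_lt_ncard ?_ hfin
  have hsub : {E ∈ 𝒟 | D ⊂ E} ⊆ {E ∈ 𝒟 | C ⊂ E} := fun E hE => ⟨hE.1, h.trans hE.2⟩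
  exact (Set.ssubset_iff_of_subset hsub).2 ⟨D, ⟨hD, h⟩, fun h' => ssubset_irrefl _ h'.2⟩

/-- An ordinal that bounds the height of a node from above. -/
noncomputable def heightBound (p : ChainTree 𝒟) : Ordinal.{u} :=
  ω * (depth 𝒟 p.1.1 : Ordinal.{u}) + (p.1.2 : Ordinal.{u})

theorem strictMono_heightBound (h𝒟 : IsTreeFamily 𝒟) :
    StrictMono (heightBound : ChainTree 𝒟 → Ordinal.{u}) := by
  intro p q hpq
  rcases lt_def.1 hpq with h | ⟨h, h'⟩
  · have hd := depth_lt h𝒟 q.2.1 p.2.1 h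
    calc heightBound p < ω * (depth 𝒟 p.1.1 : Ordinal.{u}) + ω :=
          (add_lt_add_iff_left _).2 (Ordinal.natCast_lt_omega0 _)
      _ = ω * ((depth 𝒟 p.1.1 + 1 : ℕ) : Ordinal.{u}) := by rw [Nat.cast_succ, mul_add_one]
      _ ≤ ω * (depth 𝒟 q.1.1 : Ordinal.{u}) := by gcongr; exact hd
      _ ≤ heightBound q := le_self_add
  · unfold heightBound
    rw [h]
    exact (add_lt_add_iff_left _).2 (Nat.cast_lt.2 h')

theorem heightBound_lt (p : ChainTree 𝒟) : heightBound p < ω * ω :=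
  Ordinal.lt_mul_iff.2 ⟨_, Ordinal.natCast_lt_omega0 _, _, Ordinal.natCast_lt_omega0 _, rfl⟩

theorem isOrderTree (h𝒟 : IsTreeFamily 𝒟) : IsOrderTree (ChainTree 𝒟) where
  exists_root := by
    refine ⟨⟨(Set.univ, 0), h𝒟.univ_mem, Or.inl rfl⟩, fun t => ?_⟩
    rcases (Set.subset_univ t.1.1).eq_or_ssubset with h | h
    · exact Or.inr ⟨h.symm, Nat.zero_le _⟩
    · exact Or.inl h
  wellOrdered t :=
    { trichotomous := fun a b hab hba => Subtype.ext (by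
        rcases le_or_le_of_subset (h𝒟.total _ a.1.2.1 _ b.1.2.1 _ t.2.1
          (subset_of_le a.2) (subset_of_le b.2)) with h | h
        · exact h.eq_of_not_lt hab
        · exact (h.eq_of_not_lt hba).symm)
      wf := Subrelation.wf (r := InvImage (· < ·) fun a : Set.Iic t => heightBound a.1)
        (fun h => strictMono_heightBound h𝒟 h) (InvImage.wf _ wellFounded_lt) }

/-- In a stack, the next copy of the same set is the only successor. -/
theorem not_isLeastAtPoint_of_isBranchingNode {p : ChainTree 𝒟} (hp : IsBranchingNode p) :
    ¬ IsLeastAtPoint 𝒟 p.1.1 := by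
  intro h
  let q : ChainTree 𝒟 := ⟨(p.1.1, p.1.2 + 1), p.2.1, Or.inr h⟩
  have hq : ∀ s ∈ successors p, s = q := fun s hs => by
    have hqs : q ≤ s := by
      rcases lt_def.1 hs.1 with h | ⟨h, h'⟩
      · exact Or.inl h
      · exact Or.inr ⟨h, h'⟩
    exact le_antisymm (hs.2 (lt_def.2 (Or.inr ⟨rfl, Nat.lt_succ_self _⟩)) hqs) hqs
  obtain ⟨a, ha, b, hb, hab⟩ := hp
  exact hab ((hq a ha).trans (hq b hb).symm)

theorem finite_branchingNodes_Iio (h𝒟 : IsTreeFamily 𝒟) (t : ChainTree 𝒟) :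
    {s ∈ Set.Iio t | IsBranchingNode s}.Finite := by
  refine (((h𝒟.finite _ t.2.1).prod (Set.finite_singleton 0)).preimage
    (Subtype.val_injective.injOn)).subset fun s hs => ?_
  exact ⟨⟨s.2.1, subset_of_le hs.1.le⟩,
    s.2.2.resolve_right (not_isLeastAtPoint_of_isBranchingNode hs.2)⟩

/-- The ray of all nodes whose underlying set contains `x`. -/
def rayAt (h𝒟 : IsTreeFamily 𝒟) (x : X) : RaySpace (ChainTree 𝒟) :=
  ⟨{p | x ∈ p.1.1}, by
    refine ⟨⟨fun p q hqp hp => subset_of_le hqp hp, fun p hp q hq _ => le_or_le_of_subset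
      (h𝒟.nested _ p.2.1 _ q.2.1 ⟨x, hp, hq⟩)⟩,
      ⟨⟨(Set.univ, 0), h𝒟.univ_mem, Or.inl rfl⟩, Set.mem_univ x⟩, fun p hp => ?_⟩
    by_cases h : ∃ D ∈ 𝒟, x ∈ D ∧ D ⊂ p.1.1
    · obtain ⟨D, hD, hx, hlt⟩ := h
      exact ⟨⟨(D, 0), hD, Or.inl rfl⟩, hx, lt_def.2 (Or.inl hlt)⟩
    · push Not at h
      refine ⟨⟨(p.1.1, p.1.2 + 1), p.2.1, Or.inr ⟨x, hp, fun D hD hx => ?_⟩⟩, hp,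
        lt_def.2 (Or.inr ⟨rfl, Nat.lt_succ_self _⟩)⟩
      rcases h𝒟.nested _ p.2.1 D hD ⟨x, hp, hx⟩ with hs | hs
      · exact hs
      · exact not_not.1 fun hn => h D hD hx ⟨hs, hn⟩⟩

theorem mem_rayAt (h𝒟 : IsTreeFamily 𝒟) {x : X} {p : ChainTree 𝒟} :
    p ∈ (rayAt h𝒟 x).1 ↔ x ∈ p.1.1 := Iff.rfl

theorem exists_not_subset (h𝒟 : IsTreeFamily 𝒟) {C : ℕ → Set X} (hC : ∀ n, C n ∈ 𝒟)
    (hlt : ∀ n, C (n + 1) ⊂ C n) {D : Set X} (hD : D ∈ 𝒟) : ∃ n, ¬ D ⊆ C n := by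
  by_contra! h
  exact Set.infinite_range_of_injective (strictAnti_nat_of_succ_lt hlt).injective
    ((h𝒟.finite D hD).subset (Set.range_subset_iff.2 fun n => ⟨hC n, h n⟩))

/-- If the sets along a ray have a smallest one, the ray climbs its whole stack, and a point
witnessing the stack is a preimage. Otherwise they contain a strictly decreasing sequence, and any
point of its intersection works, since no member lies inside all its terms. -/
theorem surjective_rayAt (h𝒟 : IsTreeFamily 𝒟)
    (hpt : ∀ C : ℕ → Set X, (∀ n, C n ∈ 𝒟) → (∀ n, C (n + 1) ⊂ C n) → ∃ x, ∀ n, x ∈ C n) :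
    Function.Surjective (rayAt h𝒟) := by
  intro R
  by_cases hmin : ∃ p ∈ R.1, ∀ q ∈ R.1, p.1.1 ⊆ q.1.1
  · obtain ⟨p, hp, hmin⟩ := hmin
    have hstep : ∀ q ∈ R.1, q.1.1 = p.1.1 → ∃ r ∈ R.1, r.1.1 = p.1.1 ∧ q.1.2 < r.1.2 := by
      intro q hq hqp
      obtain ⟨r, hr, hqr⟩ := R.2.2.2 q hq
      rcases lt_def.1 hqr with h | ⟨h, h'⟩
      · exact absurd (hmin r hr) (hqp ▸ h).2
      · exact ⟨r, hr, h.symm.trans hqp, h'⟩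
    have hunb : ∀ n : ℕ, ∃ r ∈ R.1, r.1.1 = p.1.1 ∧ n ≤ r.1.2 := by
      intro n
      induction n with
      | zero => exact ⟨p, hp, rfl, Nat.zero_le _⟩
      | succ n ih =>
        obtain ⟨q, hq, hqp, hn⟩ := ih
        obtain ⟨r, hr, hrp, hlt⟩ := hstep q hq hqp
        exact ⟨r, hr, hrp, hn.trans_lt hlt⟩
    -- A copy with positive index exists only if the set is smallest at some point.
    obtain ⟨r, -, hrp, hr⟩ := hunb 1
    obtain ⟨x, hx, hxmin⟩ := r.2.2.resolve_left (Nat.one_le_iff_ne_zero.1 hr)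
    rw [hrp] at hx hxmin
    refine ⟨x, Subtype.ext (Set.Subset.antisymm (fun q hq => ?_) fun q hq => hmin q hq hx)⟩
    obtain ⟨r, hr, hrp, hn⟩ := hunb q.1.2
    refine R.2.1.1 ?_ hr
    rcases (hxmin _ q.2.1 hq).eq_or_ssubset with h | h
    · exact Or.inr ⟨(hrp.trans h).symm, hn⟩
    · exact Or.inl (hrp ▸ h)
  · push Not at hmin
    have hnext : ∀ p : R.1, ∃ q : R.1, q.1.1.1 ⊂ p.1.1.1 := fun p => by
      obtain ⟨q, hq, hn⟩ := hmin p.1 p.2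
      refine ⟨⟨q, hq⟩, ?_⟩
      rcases RaySpace.le_or_le p.2 hq with h | h
      · exact h.resolve_right fun h => hn h.1.le
      · exact absurd (subset_of_le h) hn
    choose f hf using hnext
    obtain ⟨p₀, hp₀⟩ := R.2.2.1
    let s : ℕ → R.1 := fun n => f^[n] ⟨p₀, hp₀⟩
    have hs : ∀ n, (s (n + 1)).1.1.1 ⊂ (s n).1.1.1 := fun n => by
      simp only [s, Function.iterate_succ_apply']
      exact hf _
    have hmem : ∀ n, (s n).1.1.1 ∈ 𝒟 := fun n => (s n).1.2.1
    obtain ⟨x, hx⟩ := hpt (fun n => (s n).1.1.1) hmem hs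
    refine ⟨x, Subtype.ext (Set.Subset.antisymm (fun q hq => ?_) fun q hq => ?_)⟩
    · obtain ⟨n, hn⟩ := exists_not_subset h𝒟 hmem hs q.2.1
      have h := (h𝒟.nested _ q.2.1 _ (hmem n) ⟨x, hq, hx n⟩).resolve_left hn
      exact R.2.1.1 (Or.inl ⟨h, hn⟩) (s n).2
    · obtain ⟨n, hn⟩ := exists_not_subset h𝒟 hmem hs q.2.1
      rcases RaySpace.le_or_le hq (s n).2 with h | h
      · exact subset_of_le h (hx n)
      · exact absurd (subset_of_le h) hn

end ChainTree

theorem nonempty_homeomorph_chainTree [TopologicalSpace X] [T0Space X] {𝒞 : Set (Set X)}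
    (hsub : IsClopenSubbase 𝒞) (h𝒟 : IsTreeFamily (insert Set.univ 𝒞))
    (hsip : HasSingletonIntersectionProperty 𝒞) :
    Nonempty (X ≃ₜ RaySpace (ChainTree (insert Set.univ 𝒞))) := by
  have hclopen : ∀ C ∈ insert Set.univ 𝒞, IsClopen C := by
    rintro C (rfl | hC)
    · exact isClopen_univ
    · constructor
      · rw [← isOpen_compl_iff, hsub]
        exact TopologicalSpace.isOpen_generateFrom_of_mem (Or.inr ⟨C, hC, rfl⟩)
      · rw [hsub]
        exact TopologicalSpace.isOpen_generateFrom_of_mem (Or.inl hC)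
  let node (C : Set X) (hC : C ∈ 𝒞) : ChainTree (insert Set.univ 𝒞) :=
    ⟨(C, 0), Or.inr hC, Or.inl rfl⟩
  have hinj : Function.Injective (ChainTree.rayAt h𝒟) := by
    intro x y hxy
    have hiff : ∀ C ∈ 𝒞, x ∈ C ↔ y ∈ C := fun C hC => by
      rw [← ChainTree.mem_rayAt h𝒟 (p := node C hC), hxy]
      rfl
    refine Inseparable.eq (?_ : nhds x = nhds y)
    rw [hsub, TopologicalSpace.nhds_generateFrom, TopologicalSpace.nhds_generateFrom]
    refine congrArg (fun S : Set (Set X) => ⨅ s ∈ S, Filter.principal s) (Set.ext fun U => ?_)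
    refine and_congr_left ?_
    rintro (hU | ⟨C, hC, rfl⟩)
    · exact hiff U hU
    · exact not_congr (hiff C hC)
  have hsurj : Function.Surjective (ChainTree.rayAt h𝒟) := by
    refine ChainTree.surjective_rayAt h𝒟 fun C hC hlt => ?_
    -- Only the first term can be the added whole space, so the shifted sequence lies in `𝒞`.
    obtain ⟨x, hx, -⟩ := hsip (fun n => C (n + 1))
      (fun n => (hC (n + 1)).resolve_left fun h => (hlt n).2 (h ▸ Set.subset_univ _))
      fun n => hlt (n + 1)
    have hx' := Set.mem_iInter.1 hx
    refine ⟨x, fun n => ?_⟩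
    cases n with
    | zero => exact (hlt 0).1 (hx' 0)
    | succ n => exact hx' n
  let e := Equiv.ofBijective _ ⟨hinj, hsurj⟩
  have hpre : ∀ C (hC : C ∈ 𝒞), e.symm ⁻¹' C = {R | node C hC ∈ R.1} := fun C hC => by
    ext R
    conv_rhs => rw [← e.apply_symm_apply R]
    rfl
  refine ⟨⟨e, RaySpace.continuous_of_isClopen fun t => hclopen _ t.2.1, ?_⟩⟩
  change Continuous e.symm
  have hgen : ∀ U ∈ 𝒞 ∪ {U | ∃ C ∈ 𝒞, U = Cᶜ}, IsOpen (e.symm ⁻¹' U) := by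
    rintro U (hU | ⟨C, hC, rfl⟩)
    · rw [hpre U hU]
      exact (RaySpace.isClopen_setOf_mem _).isOpen
    · rw [Set.preimage_compl, hpre C hC]
      exact (RaySpace.isClopen_setOf_mem _).compl.isOpen
  have h := continuous_generateFrom_iff.2 hgen
  rwa [← hsub] at h

theorem isTreeFamily_insert_univ [TopologicalSpace X] {𝒞 : Set (Set X)}
    (hne : ∀ C ∈ 𝒞, C.Nonempty) (hsub : IsClopenSubbase 𝒞) (hnest : IsNested 𝒞)
    (hnoeth : IsNoetherianFamily 𝒞) (hcomp : IsHereditarilyComplete 𝒞)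
    (hsip : HasSingletonIntersectionProperty 𝒞) : IsTreeFamily (insert Set.univ 𝒞) := by
  have hnest' : IsNested (insert Set.univ 𝒞) := by
    rintro C (rfl | hC) D (rfl | hD) h
    · exact Or.inl le_rfl
    · exact Or.inr (Set.subset_univ _)
    · exact Or.inl (Set.subset_univ _)
    · exact hnest C hC D hD h
  refine ⟨Or.inl rfl, hnest', fun C hC D hD E hE hEC hED => ?_, ?_⟩
  -- The whole space may be empty, so nestedness through a point of `E` is not available for it.
  · rcases hE with rfl | hE
    · exact Or.inl ((Set.subset_univ C).trans hED)
    · obtain ⟨x, hx⟩ := hne E hE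
      exact hnest' C hC D hD ⟨x, hEC hx, hED hx⟩
  · rintro C (rfl | hC)
    · exact (Set.finite_singleton Set.univ).subset fun D hD => Set.univ_subset_iff.1 hD.2
    · refine ((finite_supersets hne hsub hnest hnoeth hcomp hsip hC).insert Set.univ).subset ?_
      rintro D ⟨rfl | hD, h⟩
      · exact Or.inl rfl
      · exact Or.inr ⟨hD, h⟩

end ChainTree

end TreeRays

theorem mainTheorem3 (X : Type u) [TopologicalSpace X] [T0Space X] :
    (∃ (T : Type u) (_ : PartialOrder T) (_ : TreeRays.IsOrderTree T),
        TreeRays.treeHeight T ≤ ω * ω ∧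
        (∀ R : Set T, TreeRays.IsBranchingRay R → {t ∈ R | TreeRays.IsBranchingNode t}.Finite) ∧
        Nonempty (X ≃ₜ TreeRays.RaySpace T)) ↔
    (∃ 𝒞 : Set (Set X),
        (∀ C ∈ 𝒞, C.Nonempty) ∧
        TreeRays.IsClopenSubbase 𝒞 ∧
        TreeRays.IsNested 𝒞 ∧
        TreeRays.IsNoetherianFamily 𝒞 ∧
        TreeRays.IsHereditarilyComplete 𝒞 ∧
        TreeRays.HasSingletonIntersectionProperty 𝒞) := by
  constructor
  · rintro ⟨T, _, _, hT, hB, ⟨e⟩⟩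
    exact ⟨TreeRays.coneFamily e, fun C hC => hC.1, TreeRays.isClopenSubbase_coneFamily e,
      TreeRays.isNested_coneFamily e, TreeRays.isNoetherianFamily_coneFamily e,
      TreeRays.isHereditarilyComplete_coneFamily e,
      TreeRays.hasSingletonIntersectionProperty_coneFamily hT hB e.bijective⟩
  · rintro ⟨𝒞, hne, hsub, hnest, hnoeth, hcomp, hsip⟩
    have h𝒟 := TreeRays.isTreeFamily_insert_univ hne hsub hnest hnoeth hcomp hsip
    have := TreeRays.ChainTree.isOrderTree h𝒟
    refine ⟨TreeRays.ChainTree (insert Set.univ 𝒞), inferInstance, this,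
      TreeRays.treeHeight_le_of_strictMono (TreeRays.ChainTree.strictMono_heightBound h𝒟)
        TreeRays.ChainTree.heightBound_lt, ?_,
      TreeRays.nonempty_homeomorph_chainTree hsub h𝒟 hsip⟩
    rintro R ⟨-, t, rfl⟩
    exact TreeRays.ChainTree.finite_branchingNodes_Iio h𝒟 t
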